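/- Let $\mathbb{Z}$ be regarded as a structure $(\mathbb{Z},+,1)$ in the first-order language $\{+,1\}$. An unordered $\mathbb{Z}$-group is an abelian group $G$ with a distinguished element $1$ such that $(G,+,1)$ is a model of the complete first-order theory $\mathrm{Th}(\mathbb{Z},+,1)$. For such a $G$ there is a unique group homomorphism $\mathrm{res}\colon G\to\hat{\mathbb{Z}}=\varprojlim_{n>0}\mathbb{Z}/n\mathbb{Z}$ with $\mathrm{res}(1)=1$; put $D=\ker(\mathrm{res})$. A structure $M$ is rigid if its only automorphism is the identity, and it is Leibnizian if for any distinct $a,b\in M$ there is a parameter-free first-order formula $\varphi(x)$ such that $M\models\varphi(a)$ and $M\not\models\varphi(b)$. Let $(G,+,1)$ be an unordered $\mathbb{Z}$-group. Then $(G,+,1)$ is rigid if and only if it is Leibnizian. Moreover, if $D\neq0$, then the map $d\mapsto 2d$ is an automorphism of the group $D$, and it extends to a nontrivial automorphism of the structure $(G,+,1)$. -/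

import Mathlib

open FirstOrder

/-- The function symbols of the language of `(ℤ, +, 1)`: a constant `1` and a binary `+`. -/
inductive AddOneFunc : ℕ → Type
  | one : AddOneFunc 0
  | add : AddOneFunc 2

/-- The first-order language `{+, 1}`. -/
def addOneLang : Language :=
  { Functions := AddOneFunc
    Relations := fun _ => Empty }

/-- The `{+, 1}`-structure `(M, +, 1)`. -/
instance addOneStructure (M : Type*) [Add M] [One M] : addOneLang.Structure M where
  funMap
    | .one, _ => 1
    | .add, v => v 0 + v 1
  RelMap := fun r => nomatch r

/-- A structure is rigid if it has no automorphism save the identity. -/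
def IsRigidStructure (L : Language) (M : Type*) [L.Structure M] : Prop :=
  ∀ f : M ≃[L] M, f = Language.Equiv.refl L M

/-- A structure is Leibnizian if any two distinct elements are separated by
a formula in one variable without parameters. -/
def IsLeibnizian (L : Language) (M : Type*) [L.Structure M] : Prop :=
  ∀ a b : M, a ≠ b →
    ∃ φ : L.Formula (Fin 1), φ.Realize (fun _ => a) ∧ ¬ φ.Realize (fun _ => b)

/-- `(G, +, 1)` is an unordered `ℤ`-group if it is a model of `Th(ℤ, +, 1)`. -/
def IsUnorderedZGroup (G : Type*) [AddCommGroup G] [One G] : Prop :=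
  G ⊨ addOneLang.completeTheory ℤ

/-- The ring `Ẑ`, the inverse limit of the rings `ℤ/nℤ` for `n > 0` along the reduction maps
`ℤ/nℤ → ℤ/mℤ` for `m ∣ n`. -/
def ZHat : Subring (∀ n : ℕ+, ZMod n) where
  carrier := {x | ∀ (m n : ℕ+) (h : (m : ℕ) ∣ n), ZMod.castHom h (ZMod m) (x n) = x m}
  mul_mem' := fun ha hb m n h => by
    simp only [Pi.mul_apply, map_mul]
    rw [ha m n h, hb m n h]
  one_mem' := fun m n h => by simp only [Pi.one_apply, map_one]
  add_mem' := fun ha hb m n h => by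
    simp only [Pi.add_apply, map_add]
    rw [ha m n h, hb m n h]
  zero_mem' := fun m n h => by simp only [Pi.zero_apply, map_zero]
  neg_mem' := fun ha m n h => by
    simp only [Pi.neg_apply, map_neg]
    rw [ha m n h]

namespace IsUnorderedZGroup

section Terms

variable {α : Type*}

/-- The term `s + t`. -/
def tadd (s t : addOneLang.Term α) : addOneLang.Term α :=
  Language.Functions.apply₂ (L := addOneLang) AddOneFunc.add s t

/-- The term `1`. -/
def tone : addOneLang.Term α :=
  Language.Constants.term (L := addOneLang) AddOneFunc.one

/-- The term `(n + 1) t`. -/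
def tmul (t : addOneLang.Term α) : ℕ → addOneLang.Term α
  | 0 => t
  | n + 1 => tadd (tmul t n) t

variable {M : Type*} [AddCommGroup M] [One M] (v : α → M)

theorem realize_tadd (s t : addOneLang.Term α) :
    (tadd s t).realize v = s.realize v + t.realize v := rfl

theorem realize_tone : (tone : addOneLang.Term α).realize v = 1 := rfl

theorem realize_tmul (t : addOneLang.Term α) (n : ℕ) :
    (tmul t n).realize v = (n + 1) • t.realize v := by
  induction n with
  | zero => simp [tmul]
  | succ n ih => rw [tmul, realize_tadd, ih, succ_nsmul _ (n + 1)]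

end Terms

variable {G : Type*} [AddCommGroup G] [One G]

theorem realize_of_int (hG : IsUnorderedZGroup G) (φ : addOneLang.Sentence)
    (h : ℤ ⊨ φ) : G ⊨ φ :=
  letI : G ⊨ addOneLang.completeTheory ℤ := hG
  Language.Theory.realize_sentence_of_mem (addOneLang.completeTheory ℤ)
    (Language.mem_completeTheory.2 h)

/-- The sentence `∃ y, (n + 1) y = (k + 1) 1`. -/
def dvdSentence (n k : ℕ) : addOneLang.Sentence :=
  (Language.BoundedFormula.ex (Language.Term.bdEqual
    (tmul (Language.Term.var (Sum.inr 0)) n) (tmul tone k)) :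
    addOneLang.BoundedFormula Empty 0)

theorem realize_dvdSentence {M : Type*} [AddCommGroup M] [One M] (n k : ℕ) :
    M ⊨ dvdSentence n k ↔ ∃ y : M, (n + 1) • y = (k + 1) • (1 : M) := by
  simp only [Language.Sentence.Realize, Language.Formula.Realize, dvdSentence,
    Language.BoundedFormula.realize_ex, Language.BoundedFormula.realize_bdEqual, realize_tmul,
    realize_tone]
  rfl

/-- The sentence saying that every `x` is `(n + 1) y + (k + 1) 1` for some `y` and `k ≤ n`. -/
noncomputable def remSentence (n : ℕ) : addOneLang.Sentence :=
  (Language.BoundedFormula.all (Language.BoundedFormula.ex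
    (Language.BoundedFormula.iSup fun k : Fin (n + 1) => Language.Term.bdEqual
      (Language.Term.var (Sum.inr 0))
      (tadd (tmul (Language.Term.var (Sum.inr 1)) n) (tmul tone k)))) :
    addOneLang.BoundedFormula Empty 0)

theorem realize_remSentence {M : Type*} [AddCommGroup M] [One M] (n : ℕ) :
    M ⊨ remSentence n ↔
      ∀ x : M, ∃ y : M, ∃ k : Fin (n + 1), x = (n + 1) • y + ((k : ℕ) + 1) • (1 : M) := by
  simp only [Language.Sentence.Realize, Language.Formula.Realize, remSentence,
    Language.BoundedFormula.realize_all, Language.BoundedFormula.realize_ex,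
    Language.BoundedFormula.realize_iSup, Language.BoundedFormula.realize_bdEqual, realize_tmul,
    realize_tone, realize_tadd]
  rfl

theorem exists_rem (hG : IsUnorderedZGroup G) (n : ℕ+) (x : G) :
    ∃ k : ℤ, ∃ y : G, x = (n : ℕ) • y + k • (1 : G) := by
  obtain ⟨n, rfl⟩ : ∃ m : ℕ, n = m.succPNat := ⟨n.natPred, by simp⟩
  have h : ℤ ⊨ remSentence n := by
    rw [realize_remSentence]
    intro x
    have hn : (0 : ℤ) < n + 1 := by positivity
    have h0 := Int.emod_nonneg (x - 1) hn.ne'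
    have h1 := Int.emod_lt_of_pos (x - 1) hn
    refine ⟨(x - 1) / (n + 1), ⟨((x - 1) % (n + 1)).toNat, by omega⟩, ?_⟩
    have h2 := Int.mul_ediv_add_emod (x - 1) (n + 1)
    simp only [nsmul_eq_mul]
    push_cast
    rw [Int.toNat_of_nonneg h0]
    linarith
  obtain ⟨y, k, hk⟩ := (realize_remSentence n).1 (realize_of_int hG _ h) x
  refine ⟨((k : ℕ) + 1 : ℕ), y, ?_⟩
  rw [natCast_zsmul]
  exact hk

theorem dvd_of_smul_eq (hG : IsUnorderedZGroup G) (n : ℕ+) (k : ℤ) (y : G)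
    (h : (n : ℕ) • y = k • (1 : G)) : (n : ℤ) ∣ k := by
  obtain ⟨n, rfl⟩ : ∃ m : ℕ, n = m.succPNat := ⟨n.natPred, by simp⟩
  simp only [Nat.succPNat_coe, Nat.succ_eq_add_one] at h ⊢
  have hn : (0 : ℤ) < ((n + 1 : ℕ) : ℤ) := by positivity
  by_contra hk
  have h0 : 0 < k % ((n + 1 : ℕ) : ℤ) :=
    lt_of_le_of_ne (Int.emod_nonneg k hn.ne') fun h' => hk (Int.dvd_of_emod_eq_zero h'.symm)
  obtain ⟨r, hr⟩ : ∃ r : ℕ, k % ((n + 1 : ℕ) : ℤ) = ((r + 1 : ℕ) : ℤ) :=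
    ⟨(k % ((n + 1 : ℕ) : ℤ) - 1).toNat, by omega⟩
  have hG' : G ⊨ dvdSentence n r := by
    rw [realize_dvdSentence]
    refine ⟨y - (k / ((n + 1 : ℕ) : ℤ)) • (1 : G), ?_⟩
    rw [smul_sub, h, ← natCast_zsmul, ← natCast_zsmul, smul_smul, ← sub_smul, ← hr,
      Int.emod_def]
  have hZ : ¬ ℤ ⊨ dvdSentence n r := by
    rw [realize_dvdSentence]
    rintro ⟨z, hz⟩
    simp only [nsmul_eq_mul, mul_one] at hz
    have h1 := Int.emod_lt_of_pos k hn
    rw [hr, ← hz] at h1 h0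
    have hz0 : 0 < z := pos_of_mul_pos_right h0 hn.le
    nlinarith
  have hneg : G ⊨ (dvdSentence n r).not :=
    realize_of_int hG _ ((Language.Sentence.realize_not (φ := dvdSentence n r) ℤ).2 hZ)
  exact (Language.Sentence.realize_not (φ := dvdSentence n r) G).1 hneg hG'

theorem existsUnique_residueMap (hG : IsUnorderedZGroup G) : ∃! f : G →+ ZHat, f 1 = 1 := by
  choose k y hky using exists_rem hG
  have key : ∀ (n : ℕ+) (x : G) (j : ℤ) (z : G), x = (n : ℕ) • z + j • (1 : G) →
      ((k n x : ℤ) : ZMod n) = (j : ZMod n) := by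
    intro n x j z hx
    rw [ZMod.intCast_eq_intCast_iff_dvd_sub]
    refine dvd_of_smul_eq hG n _ (y n x - z) ?_
    have h := (hky n x).symm.trans hx
    rw [smul_sub, sub_smul, sub_eq_sub_iff_add_eq_add, h, add_comm]
  refine ⟨⟨⟨fun x => ⟨fun n => (k n x : ZMod n), ?_⟩, ?_⟩, ?_⟩, ?_, ?_⟩
  · intro m n hmn
    rw [map_intCast]
    obtain ⟨c, hc⟩ := hmn
    refine (key m x (k n x) (c • y n x) ?_).symm
    rw [smul_smul, ← hc]
    exact hky n x
  · ext n
    refine (key n 0 0 0 (by simp)).trans (by simp)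
  · intro a b
    ext n
    refine (key n (a + b) (k n a + k n b) (y n a + y n b) ?_).trans (by simp)
    conv_lhs => rw [hky n a, hky n b]
    rw [smul_add, add_smul]
    abel
  · ext n
    refine (key n 1 1 0 (by simp)).trans (by simp)
  · intro f hf
    ext x n
    change (f x).1 n = (k n x : ZMod n)
    conv_lhs => rw [hky n x]
    rw [map_add, map_nsmul, map_zsmul, hf]
    change (n : ℕ) • (f (y n x)).1 n + k n x • (1 : ZMod n) = _
    simp

/-- The residue map `G → Ẑ`: the unique group homomorphism sending `1` to `1`. -/
noncomputable def residueMap (hG : IsUnorderedZGroup G) : G →+ ZHat :=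
  hG.existsUnique_residueMap.choose

theorem residueMap_one (hG : IsUnorderedZGroup G) : hG.residueMap 1 = 1 :=
  hG.existsUnique_residueMap.choose_spec.1

end IsUnorderedZGroup

/-! `D`, the kernel of the residue map, consists of the elements divisible by every `n > 0`. As `G`
is torsion-free, `D` is itself divisible, hence an injective `ℤ`-module, and it meets `ℤ • 1` only
in `0`. So the projection `D ⊕ ℤ • 1 → D` extends to `p : G → D` (`exists_retraction`), and `x ↦ x +
p x` is an automorphism fixing `1` and doubling `D`. It is nontrivial if `D ≠ 0`, so rigidity forces
`D = 0`. Distinct elements are then incongruent modulo some `n`, which a formula detects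
(`isLeibnizian_of_ker_eq_bot`). Conversely, automorphisms preserve formulas, so Leibnizian implies
rigid. -/

namespace IsUnorderedZGroup

/-- The sentence `∀ x y, (n + 1) x = (n + 1) y → x = y`. -/
def cancelSentence (n : ℕ) : addOneLang.Sentence :=
  (Language.BoundedFormula.all (Language.BoundedFormula.all (Language.BoundedFormula.imp
    (Language.Term.bdEqual (tmul (Language.Term.var (Sum.inr 0)) n)
      (tmul (Language.Term.var (Sum.inr 1)) n))
    (Language.Term.bdEqual (Language.Term.var (Sum.inr 0)) (Language.Term.var (Sum.inr 1))))) :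
    addOneLang.BoundedFormula Empty 0)

theorem realize_cancelSentence {M : Type*} [AddCommGroup M] [One M] (n : ℕ) :
    M ⊨ cancelSentence n ↔ ∀ x y : M, (n + 1) • x = (n + 1) • y → x = y := by
  simp only [Language.Sentence.Realize, Language.Formula.Realize, cancelSentence,
    Language.BoundedFormula.realize_all, Language.BoundedFormula.realize_imp,
    Language.BoundedFormula.realize_bdEqual, realize_tmul]
  rfl

/-- The formula `∃ y, x = (n + 1) y + (k + 1) 1` in the variable `x`. -/
def congrFormula (n k : ℕ) : addOneLang.Formula (Fin 1) :=
  (Language.BoundedFormula.ex (Language.Term.bdEqual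
    (Language.Term.var (Sum.inl 0))
    (tadd (tmul (Language.Term.var (Sum.inr 0)) n) (tmul tone k))) :
    addOneLang.BoundedFormula (Fin 1) 0)

theorem realize_congrFormula {M : Type*} [AddCommGroup M] [One M] (n k : ℕ) (x : M) :
    (congrFormula n k).Realize (fun _ => x) ↔
      ∃ y : M, x = (n + 1) • y + (k + 1) • (1 : M) := by
  simp only [Language.Formula.Realize, congrFormula, Language.BoundedFormula.realize_ex,
    Language.BoundedFormula.realize_bdEqual, realize_tmul, realize_tone, realize_tadd]
  rfl

variable {G : Type*} [AddCommGroup G] [One G]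

theorem nsmul_cancel (hG : IsUnorderedZGroup G) (n : ℕ+) {x y : G}
    (h : (n : ℕ) • x = (n : ℕ) • y) : x = y := by
  obtain ⟨n, rfl⟩ : ∃ m : ℕ, n = m.succPNat := ⟨n.natPred, by simp⟩
  have hZ : ℤ ⊨ cancelSentence n := by
    rw [realize_cancelSentence]
    intro x y hxy
    simp only [nsmul_eq_mul] at hxy
    exact mul_left_cancel₀ (by positivity) hxy
  exact (realize_cancelSentence n).1 (realize_of_int hG _ hZ) x y h

/-- If `x = n y + k 1`, the residue of `x` at `n` is `k`; when it vanishes, `n ∣ k` and `k 1` is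
absorbed into the multiple of `n`. -/
theorem mem_ker_residueMap (hG : IsUnorderedZGroup G) {x : G} :
    x ∈ hG.residueMap.ker ↔ ∀ n : ℕ+, ∃ y : G, x = (n : ℕ) • y := by
  rw [AddMonoidHom.mem_ker]
  constructor
  · intro hx n
    obtain ⟨k, y, h⟩ := hG.exists_rem n x
    have h0 : (hG.residueMap x).1 n = 0 := by rw [hx]; rfl
    rw [h, map_add, map_nsmul, map_zsmul, residueMap_one] at h0
    change (n : ℕ) • (hG.residueMap y).1 n + k • (1 : ZMod n) = 0 at h0
    simp only [nsmul_eq_mul, CharP.cast_eq_zero, zero_mul, zero_add, zsmul_eq_mul, mul_one] at h0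
    obtain ⟨c, rfl⟩ := (ZMod.intCast_zmod_eq_zero_iff_dvd k n).1 h0
    refine ⟨y + c • (1 : G), ?_⟩
    rw [smul_add, ← natCast_zsmul (c • (1 : G)), smul_smul]
    exact h
  · intro h
    ext n
    obtain ⟨y, rfl⟩ := h n
    rw [map_nsmul]
    change (n : ℕ) • (hG.residueMap y).1 n = 0
    simp

theorem exists_mem_ker_nsmul_eq (hG : IsUnorderedZGroup G) (n : ℕ+) (d : hG.residueMap.ker) :
    ∃ e : hG.residueMap.ker, (n : ℕ) • e = d := by
  obtain ⟨y, hy⟩ := hG.mem_ker_residueMap.1 d.2 n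
  refine ⟨⟨y, hG.mem_ker_residueMap.2 fun m => ?_⟩, Subtype.ext hy.symm⟩
  -- Dividing `d` by `n * m` and cancelling `n` shows that the quotient `y` is divisible by `m`.
  obtain ⟨z, hz⟩ := hG.mem_ker_residueMap.1 d.2 (n * m)
  refine ⟨z, hG.nsmul_cancel n ?_⟩
  rw [← hy, hz, PNat.mul_coe, mul_smul]

theorem zsmul_surjective_ker (hG : IsUnorderedZGroup G) {n : ℤ} (hn : n ≠ 0) :
    Function.Surjective fun d : hG.residueMap.ker => n • d := by
  intro d
  obtain ⟨e, he⟩ := hG.exists_mem_ker_nsmul_eq ⟨n.natAbs, Int.natAbs_pos.2 hn⟩ d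
  rw [PNat.mk_coe, ← natCast_zsmul] at he
  rcases Int.natAbs_eq n with h | h
  · exact ⟨e, by rw [← he, ← h]⟩
  · refine ⟨-e, ?_⟩
    change n • (-e) = d
    rw [smul_neg, ← neg_smul, ← he]
    congr 1
    omega

theorem eq_zero_of_zsmul_one_mem_ker (hG : IsUnorderedZGroup G) {k : ℤ}
    (hk : k • (1 : G) ∈ hG.residueMap.ker) : k = 0 := by
  -- A modulus exceeding `|k|` divides `k` only if `k = 0`.
  obtain ⟨y, hy⟩ := hG.mem_ker_residueMap.1 hk ⟨k.natAbs + 1, Nat.succ_pos _⟩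
  refine Int.eq_zero_of_abs_lt_dvd (hG.dvd_of_smul_eq _ k y hy.symm) ?_
  rw [PNat.mk_coe, Int.abs_eq_natAbs]
  omega

/-- The kernel of the residue map is a direct summand with a complement containing `1`. -/
theorem exists_retraction (hG : IsUnorderedZGroup G) :
    ∃ p : G →+ hG.residueMap.ker, p 1 = 0 ∧ ∀ d : hG.residueMap.ker, p d = d := by
  let : DivisibleBy hG.residueMap.ker ℤ :=
    divisibleByOfSMulRightSurj _ _ fun {_} => hG.zsmul_surjective_ker
  let i : hG.residueMap.ker × ℤ →ₗ[ℤ] G :=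
    (hG.residueMap.ker.subtype.toIntLinearMap).coprod (LinearMap.toSpanSingleton ℤ G 1)
  have hi (d : hG.residueMap.ker) (k : ℤ) : i (d, k) = d + k • (1 : G) := rfl
  have hinj : Function.Injective i := by
    rw [injective_iff_map_eq_zero]
    rintro ⟨d, k⟩ h
    rw [hi] at h
    obtain rfl : k = 0 := by
      refine hG.eq_zero_of_zsmul_one_mem_ker ?_
      rw [← neg_eq_of_add_eq_zero_right h]
      exact neg_mem d.2
    rw [zero_smul, add_zero] at h
    exact Prod.ext (Subtype.ext h) rfl
  -- Injectivity of `D` extends the first projection along the embedding `i`.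
  obtain ⟨p, hp⟩ := (Module.Baer.of_divisible hG.residueMap.ker).extension_property i hinj
    (LinearMap.fst ℤ _ _)
  refine ⟨p.toAddMonoidHom, ?_, fun d => ?_⟩
  · have h := LinearMap.congr_fun hp (0, 1)
    rw [LinearMap.comp_apply, hi] at h
    simpa using h
  · have h := LinearMap.congr_fun hp (d, 0)
    rw [LinearMap.comp_apply, hi] at h
    simpa using h

theorem bijective_two_nsmul_ker (hG : IsUnorderedZGroup G) :
    Function.Bijective (nsmulAddMonoidHom (α := hG.residueMap.ker) 2) :=
  ⟨fun _ _ h => Subtype.ext (hG.nsmul_cancel 2 (congrArg Subtype.val h)),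
    fun d => hG.exists_mem_ker_nsmul_eq 2 d⟩

/-- The automorphism `d ↦ 2 d` of the kernel of the residue map. -/
noncomputable def doubleKer (hG : IsUnorderedZGroup G) :
    hG.residueMap.ker ≃+ hG.residueMap.ker :=
  AddEquiv.ofBijective _ hG.bijective_two_nsmul_ker

theorem doubleKer_apply (hG : IsUnorderedZGroup G) (d : hG.residueMap.ker) :
    hG.doubleKer d = 2 • d := rfl

/-- An additive automorphism fixing `1` is an automorphism of the `{+, 1}`-structure. -/
def equivOfAddEquiv (f : G ≃+ G) (hf : f 1 = 1) : G ≃[addOneLang] G where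
  toEquiv := f.toEquiv
  map_fun' := by
    rintro _ (_ | _) v
    · exact hf
    · exact map_add f (v 0) (v 1)
  map_rel' := fun r => nomatch r

theorem exists_equiv_extending_doubleKer (hG : IsUnorderedZGroup G) :
    ∃ f : G ≃[addOneLang] G, ∀ d : hG.residueMap.ker, f (d : G) = (hG.doubleKer d : G) := by
  obtain ⟨p, hp1, hp⟩ := hG.exists_retraction
  have hhalf (d : hG.residueMap.ker) : hG.doubleKer.symm d + hG.doubleKer.symm d = d := by
    rw [← two_nsmul, ← doubleKer_apply, AddEquiv.apply_symm_apply]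
  have hhalf' (d : hG.residueMap.ker) : hG.doubleKer.symm (d + d) = d := by
    rw [← two_nsmul, ← doubleKer_apply, AddEquiv.symm_apply_apply]
  -- `f` doubles `D` and fixes `ker p` pointwise, so its inverse subtracts half of the
  -- `D`-component.
  let f : G ≃+ G :=
    { toFun := fun x => x + p x
      invFun := fun x => x - hG.doubleKer.symm (p x)
      left_inv := fun x => by
        simp only [map_add p, hp, hhalf', add_sub_cancel_right]
      right_inv := fun x => by
        simp only [map_sub p, hp]
        nth_rw 2 [← hhalf (p x)]
        rw [add_sub_cancel_right, sub_add_cancel]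
      map_add' := fun x y => by
        rw [map_add, AddSubgroup.coe_add]
        abel }
  have hf (x : G) : f x = x + p x := rfl
  refine ⟨equivOfAddEquiv f (by rw [hf, hp1, AddSubgroup.coe_zero, add_zero]), fun d => ?_⟩
  change f d = _
  rw [hf, hp, doubleKer_apply, two_nsmul, AddSubgroup.coe_add]

theorem ne_refl_of_extends_doubleKer (hG : IsUnorderedZGroup G) (hD : hG.residueMap.ker ≠ ⊥)
    {f : G ≃[addOneLang] G} (hf : ∀ d : hG.residueMap.ker, f (d : G) = (hG.doubleKer d : G)) :
    f ≠ Language.Equiv.refl addOneLang G := by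
  rintro rfl
  refine hD ((AddSubgroup.eq_bot_iff_forall _).2 fun d hd => ?_)
  have h := hf ⟨d, hd⟩
  rw [doubleKer_apply, two_nsmul] at h
  exact left_eq_add.1 h

theorem isLeibnizian_of_ker_eq_bot (hG : IsUnorderedZGroup G) (hD : hG.residueMap.ker = ⊥) :
    IsLeibnizian addOneLang G := by
  intro a b hab
  have hmem : a - b ∉ hG.residueMap.ker := by
    rw [hD, AddSubgroup.mem_bot]
    exact sub_ne_zero.2 hab
  obtain ⟨n, hn⟩ : ∃ n : ℕ+, ∀ y : G, a - b ≠ (n : ℕ) • y := by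
    simpa using mt hG.mem_ker_residueMap.2 hmem
  obtain ⟨n, rfl⟩ : ∃ m : ℕ, n = m.succPNat := ⟨n.natPred, by simp⟩
  simp only [Nat.succPNat_coe, Nat.succ_eq_add_one] at hn
  obtain ⟨k, y, hk⟩ : ∃ k : ℕ, ∃ y : G, a = (n + 1) • y + (k + 1) • (1 : G) := by
    -- The shift by `1` matches the coefficient `k + 1` in `congrFormula`; reducing `j` modulo `n +
    -- 1` makes `k` a natural number.
    obtain ⟨j, y, hj⟩ := hG.exists_rem n.succPNat (a - 1)
    obtain ⟨k, hk⟩ := Int.eq_ofNat_of_zero_le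
      (Int.emod_nonneg j (by positivity : ((n + 1 : ℕ) : ℤ) ≠ 0))
    refine ⟨k, y + (j / ((n + 1 : ℕ) : ℤ)) • (1 : G), ?_⟩
    rw [Nat.succPNat_coe, Nat.succ_eq_add_one, ← Int.mul_ediv_add_emod j ((n + 1 : ℕ) : ℤ), hk,
      add_smul (_ : ℤ), mul_smul, natCast_zsmul, natCast_zsmul] at hj
    rw [sub_eq_iff_eq_add.1 hj, smul_add, add_smul k 1, one_smul]
    abel
  refine ⟨congrFormula n k, (realize_congrFormula n k a).2 ⟨y, hk⟩, fun hb => ?_⟩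
  obtain ⟨z, hz⟩ := (realize_congrFormula n k b).1 hb
  refine hn (y - z) ?_
  rw [hk, hz, smul_sub]
  abel

end IsUnorderedZGroup

theorem IsLeibnizian.isRigidStructure {L : Language} {M : Type*} [L.Structure M]
    (h : IsLeibnizian L M) : IsRigidStructure L M := by
  intro f
  ext x
  by_contra hne
  obtain ⟨φ, h1, h2⟩ := h _ _ hne
  exact h2 ((Language.StrongHomClass.realize_formula f φ).1 h1)

theorem mainTheorem8 {G : Type*} [AddCommGroup G] [One G] (hG : IsUnorderedZGroup G) :
    (IsRigidStructure addOneLang G ↔ IsLeibnizian addOneLang G) ∧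
    (hG.residueMap.ker ≠ ⊥ →
      ∃ g : hG.residueMap.ker ≃+ hG.residueMap.ker, (∀ d, g d = 2 • d) ∧
        ∃ f : G ≃[addOneLang] G,
          (∀ d : hG.residueMap.ker, f (d : G) = (g d : G)) ∧
          f ≠ Language.Equiv.refl addOneLang G) := by
  obtain ⟨f, hf⟩ := hG.exists_equiv_extending_doubleKer
  refine ⟨⟨fun hrigid => hG.isLeibnizian_of_ker_eq_bot ?_, fun h => h.isRigidStructure⟩,
    fun hD => ⟨hG.doubleKer, hG.doubleKer_apply, f, hf, hG.ne_refl_of_extends_doubleKer hD hf⟩⟩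
  by_contra hD
  exact hG.ne_refl_of_extends_doubleKer hD hf (hrigid f)
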